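/- Let $n$ be a natural number and let $\mathfrak L_n$ be the set of Laplacian matrices of connected, undirected, simple graphs on $n$ nodes with positive link weights. For $L\in\mathfrak L_n$ with eigenvalues $0=\lambda_1<\lambda_2\le\dots\le\lambda_n$, consider the consensus network $\dot x=-Lx+\xi$, $y=M_nx$, where $M_n=I_n-\frac1nJ_n$ and $J_n$ is the all-ones matrix. Let $G(s)=M_n(sI_n+L)^{-1}$ be its transfer matrix from $\xi$ to $y$, and let $\sigma_1\ge\dots\ge\sigma_n$ denote singular values. Define $$\|G\|_{\mathcal H_p}=\Big\{\frac1{2\pi}\int_{-\infty}^{\infty}\sum_{k=1}^n\sigma_k(G(j\omega))^p\,d\omega\Big\}^{1/p}\ (1<p<\infty),\qquad \|G\|_{\mathcal H_\infty}=\operatorname*{ess\,sup}_{\omega\in\mathbb R}\sigma_1(G(j\omega)),$$ $$\zeta_q(L)=\Big(\sum_{i=2}^n\lambda_i^{-q}\Big)^{1/q}\ (1\le q<\infty),\qquad \zeta_\infty(L)=\max_{2\le i\le n}\lambda_i^{-1}$$ (the maximum of the empty set being $0$), and $\alpha_0=\alpha_0(p)$ by $\alpha_0(p)^{-1}=\big(-\beta(\tfrac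 p2,-\tfrac12)\big)^{1/p}$ for $p<\infty$, $\alpha_0(\infty)=1$, where $\beta(x,y)=\Gamma(x)\Gamma(y)/\Gamma(x+y)$. A function $\rho:\mathfrak L_n\to\mathbb R$ is called a systemic performance measure if it is monotone ($L_2\preceq L_1$ in the positive semidefinite order implies $\rho(L_1)\le\rho(L_2)$), convex on the set $\mathfrak L_n$ (which is convex), and orthogonally invariant ($\rho(ULU^{\mathsf T})=\rho(L)$ whenever $U$ is orthogonal and $L,ULU^{\mathsf T}\in\mathfrak L_n$). Theorem. Let $2\le p\le\infty$. Then $\|G\|_{\mathcal H_p}$ is finite and, as a function of $L\in\mathfrak L_n$, is a systemic performance measure. Moreover, for every $L\in\mathfrak L_n$, $$\|G\|_{\mathcal H_p}=\alpha_0(p)\,\zeta_{p-1}(L)^{\,1-\frac1p},$$ where for $p=\infty$ the subscript $p-1$ is $\infty$ and the exponent $1-\frac1p$ is $1$. The values at $\infty$ are limits: as $r\to\infty$, $\alpha_0(r)\to\alpha_0(\infty)$, and $\zeta_r(L)\to\zeta_\infty(L)$ and $\|G\|_{\mathcal H_r}\to\|G\|_{\mathcal H_\infty}$ for every $L\in\mathfrak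 L_n$. -/

import Mathlib

open MeasureTheory Filter Topology
open scoped ENNReal Matrix

namespace ConsensusNetwork

noncomputable section

/-- The coupling graph of a gain matrix `K`: `{i, j}` is a link iff `i ≠ j` and the gain between
`i` and `j` does not vanish. -/
def couplingGraph {n : ℕ} (K : Matrix (Fin n) (Fin n) ℝ) : SimpleGraph (Fin n) :=
  SimpleGraph.fromRel fun i j => K i j ≠ 0

/-- Feedback gains of a linear consensus network: nonnegative, symmetric, without self-loops, and
with a connected coupling graph. -/
structure IsFeedbackGain {n : ℕ} (K : Matrix (Fin n) (Fin n) ℝ) : Prop where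
  nonneg : ∀ i j, 0 ≤ K i j
  symm : ∀ i j, K i j = K j i
  simple : ∀ i, K i i = 0
  connected : (couplingGraph K).Connected

/-- The Laplacian matrix `Δ - A` of a weighted graph with adjacency matrix `K`. -/
def laplacian {n : ℕ} (K : Matrix (Fin n) (Fin n) ℝ) : Matrix (Fin n) (Fin n) ℝ :=
  Matrix.diagonal (fun i => ∑ j, K i j) - K

/-- The set of Laplacian matrices of all connected weighted graphs with `n` nodes. -/
def laplacians (n : ℕ) : Set (Matrix (Fin n) (Fin n) ℝ) :=
  {L | ∃ K, IsFeedbackGain K ∧ L = laplacian K}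

theorem isHermitian_of_mem_laplacians {n : ℕ} {L : Matrix (Fin n) (Fin n) ℝ}
    (hL : L ∈ laplacians n) : L.IsHermitian := by
  obtain ⟨K, hK, rfl⟩ := hL
  refine (Matrix.isHermitian_diagonal _).sub ?_
  ext i j
  simpa using hK.symm j i

/-- A systemic performance measure: an operator on the Laplacian matrices of connected weighted
graphs with `n` nodes (only the values of `ρ` on `laplacians n` matter) that is monotone with
respect to the positive semidefinite order, convex, and orthogonally invariant. -/
structure IsSystemicPerformanceMeasure {n : ℕ} (ρ : Matrix (Fin n) (Fin n) ℝ → ℝ) : Prop where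
  monotone : ∀ L₁ ∈ laplacians n, ∀ L₂ ∈ laplacians n, (L₁ - L₂).PosSemidef → ρ L₁ ≤ ρ L₂
  convex : ConvexOn ℝ (laplacians n) ρ
  orthogonal_invariant : ∀ L ∈ laplacians n, ∀ U ∈ Matrix.orthogonalGroup (Fin n) ℝ,
    U * L * Uᵀ ∈ laplacians n → ρ L = ρ (U * L * Uᵀ)

/-- The eigenvalues of a symmetric matrix in ascending order, repeated according to multiplicity;
index `0` is the smallest one. (Mathlib's `eigenvalues₀` is in descending order.) -/
def eigenvalue {n : ℕ} {L : Matrix (Fin n) (Fin n) ℝ} (hL : L.IsHermitian) (i : Fin n) : ℝ :=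
  hL.eigenvalues₀ (Fin.cast (Fintype.card_fin n).symm i.rev)

/-- The spectral zeta function of order `q`: `(∑ λ_i ^ (-q)) ^ (1 / q)`, the sum being over all the
eigenvalues except the smallest one; for `q = ∞` it is the largest of the numbers `λ_i⁻¹`. -/
def spectralZeta {n : ℕ} {L : Matrix (Fin n) (Fin n) ℝ} (hL : L.IsHermitian) (q : ℝ≥0∞) : ℝ :=
  if q = ∞ then ⨆ i : {i : Fin n // 0 < (i : ℕ)}, (eigenvalue hL i)⁻¹
  else (∑ i : {i : Fin n // 0 < (i : ℕ)}, eigenvalue hL i ^ (-q.toReal)) ^ (1 / q.toReal)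

/-- The centering matrix `I - J / n`. -/
def centering (n : ℕ) : Matrix (Fin n) (Fin n) ℝ :=
  1 - (1 / (n : ℝ)) • Matrix.of fun _ _ => 1

/-- The transfer matrix `s ↦ C (s I - A)⁻¹ B` of the system `x' = A x + B ξ`, `y = C x`. -/
def transferMatrix {n : ℕ} (A B C : Matrix (Fin n) (Fin n) ℝ) (s : ℂ) :
    Matrix (Fin n) (Fin n) ℂ :=
  C.map Complex.ofReal * (s • 1 - A.map Complex.ofReal)⁻¹ * B.map Complex.ofReal

/-- The `k`-th singular value of a square complex matrix, in descending order; index `0` is the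
largest one. -/
def singularValue {n : ℕ} (G : Matrix (Fin n) (Fin n) ℂ) (k : ℕ) : ℝ :=
  (Matrix.toEuclideanLin G).singularValues k

/-- The `p`-Hardy-Schatten norm of a transfer matrix, with values in `[0, ∞]`:
`((1 / 2π) ∫ ∑ₖ σₖ(G(jω)) ^ p dω) ^ (1 / p)`, and for `p = ∞` the usual `H_∞`-norm, the essential
supremum of the largest singular value of `G(jω)`. -/
def hardySchattenNorm {n : ℕ} (p : ℝ≥0∞) (G : ℂ → Matrix (Fin n) (Fin n) ℂ) : ℝ≥0∞ :=
  if p = ∞ then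
    essSup (fun ω : ℝ => ENNReal.ofReal (singularValue (G (Complex.I * ω)) 0)) volume
  else
    (ENNReal.ofReal (1 / (2 * Real.pi)) * ∫⁻ ω : ℝ, ∑ k : Fin n,
      ENNReal.ofReal (singularValue (G (Complex.I * ω)) k ^ p.toReal)) ^ (1 / p.toReal)

/-- The `p`-Hardy-Schatten norm of the consensus network `x' = -L x + ξ`, `y = Mₙ x`. -/
def networkNorm {n : ℕ} (p : ℝ≥0∞) (L : Matrix (Fin n) (Fin n) ℝ) : ℝ≥0∞ :=
  hardySchattenNorm p (transferMatrix (-L) 1 (centering n))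

/-- The constant `α₀` with `α₀⁻¹ = (-β(p/2, -1/2)) ^ (1/p)`, and `α₀ = 1` for `p = ∞`, which is the
limit. Here `ProbabilityTheory.beta a b` is `Γ(a) Γ(b) / Γ(a + b)`, for all real `a` and `b`. -/
def alphaZero (p : ℝ≥0∞) : ℝ :=
  if p = ∞ then 1
  else ((-ProbabilityTheory.beta (p.toReal / 2) (-1 / 2)) ^ (1 / p.toReal))⁻¹

end

end ConsensusNetwork

/-!
The Laplacian matrices of connected graphs all have kernel spanned by the all-ones vector, so they
can be compared as positive definite matrices on its orthogonal complement, the range of the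
centering matrix. In an eigenbasis `λ_i` of `L` there, `G(jω)` is diagonal with entries
`(jω + λ_i)⁻¹`, so its nonzero singular values are `(λ_i² + ω²)^(-1/2)`. Writing their `p`-th powers
as Gamma integrals and exchanging the order of integration leaves a Gaussian integral in `ω`, which
gives a multiple of `∑ λ_i^(-(p-1))`. Peierls' inequality bounds such a spectral sum from below by
the same sum over the diagonal entries in any other orthonormal basis; in the eigenbasis of the
larger matrix, or of the convex combination, monotonicity and convexity become statements about
numbers, and the log-convexity of `∑ x_i^(-q)` makes its `1/p`-th power convex too. For `p = ∞` the
largest singular value extends continuously from `ω ≠ 0` to `ω = 0`, where it is largest, and the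
inequalities pass to the limit.
-/

namespace ConsensusNetwork

section Convexity

variable {ι : Type*} {q t a b : ℝ}

theorem convexOn_rpow_neg (hq : 0 ≤ q) : ConvexOn ℝ (Set.Ioi 0) fun x : ℝ => x ^ (-q) := by
  have hlog : ConvexOn ℝ (Set.Ioi 0) fun x : ℝ => q * -Real.log x :=
    strictConcaveOn_log_Ioi.concaveOn.neg.smul hq
  have hexp : ConvexOn ℝ (Set.Ioi 0) fun x : ℝ => Real.exp (q * -Real.log x) :=
    ⟨hlog.1, fun _ hx _ hy _ _ ha hb hab => (Real.exp_le_exp.2 (hlog.2 hx hy ha hb hab)).trans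
      (convexOn_exp.2 trivial trivial ha hb hab)⟩
  refine hexp.congr fun x hx => ?_
  simp only [Real.rpow_def_of_pos hx, mul_neg, neg_mul, mul_comm (Real.log x)]

theorem rpow_right_comm {x : ℝ} (hx : 0 ≤ x) (a b : ℝ) : (x ^ a) ^ b = (x ^ b) ^ a := by
  rw [← Real.rpow_mul hx, mul_comm, Real.rpow_mul hx]

theorem antitoneOn_rpow_neg (hq : 0 ≤ q) : AntitoneOn (fun x : ℝ => x ^ (-q)) (Set.Ioi 0) :=
  fun _ hx _ _ hxy => Real.rpow_le_rpow_of_nonpos hx hxy (neg_nonpos.2 hq)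

theorem sum_rpow_mul_rpow_le (s : Finset ι) {u v : ι → ℝ} (hu : ∀ i, 0 ≤ u i)
    (hv : ∀ i, 0 ≤ v i) (ha : 0 < a) (hb : 0 < b) (hab : a + b = 1) :
    ∑ i ∈ s, u i ^ a * v i ^ b ≤ (∑ i ∈ s, u i) ^ a * (∑ i ∈ s, v i) ^ b := by
  have hconj : a⁻¹.HolderConjugate b⁻¹ :=
    Real.holderConjugate_iff.2 ⟨(one_lt_inv₀ ha).2 (by linarith), by simpa using hab⟩
  have hroot {x c : ℝ} (hx : 0 ≤ x) (hc : 0 < c) : |x ^ c| ^ c⁻¹ = x := by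
    rw [abs_of_nonneg (Real.rpow_nonneg hx c), Real.rpow_rpow_inv hx hc.ne']
  simpa only [hroot (hu _) ha, hroot (hv _) hb, one_div, inv_inv] using
    Real.inner_le_Lp_mul_Lq s (fun i => u i ^ a) (fun i => v i ^ b) hconj

theorem sum_rpow_neg_le_mul [Fintype ι] {x y : ι → ℝ} (hx : ∀ i, 0 < x i) (hy : ∀ i, 0 < y i)
    (ha : 0 < a) (hb : 0 < b) (hab : a + b = 1) (hq : 0 ≤ q) :
    ∑ i, (a * x i + b * y i) ^ (-q) ≤ (∑ i, x i ^ (-q)) ^ a * (∑ i, y i ^ (-q)) ^ b := by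
  refine le_trans (Finset.sum_le_sum fun i _ => ?_) (sum_rpow_mul_rpow_le Finset.univ
    (fun i => Real.rpow_nonneg (hx i).le _) (fun i => Real.rpow_nonneg (hy i).le _) ha hb hab)
  calc (a * x i + b * y i) ^ (-q) ≤ (x i ^ a * y i ^ b) ^ (-q) :=
        Real.rpow_le_rpow_of_nonpos
          (mul_pos (Real.rpow_pos_of_pos (hx i) a) (Real.rpow_pos_of_pos (hy i) b))
          (Real.geom_mean_le_arith_mean2_weighted ha.le hb.le (hx i).le (hy i).le hab)
          (neg_nonpos.2 hq)
    _ = (x i ^ (-q)) ^ a * (y i ^ (-q)) ^ b := by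
        rw [Real.mul_rpow (Real.rpow_nonneg (hx i).le _) (Real.rpow_nonneg (hy i).le _),
          rpow_right_comm (hx i).le, rpow_right_comm (hy i).le]

-- The power sum is even log-convex, which is why every power `t ≥ 0` of it remains convex.
theorem convexOn_sum_rpow_neg_rpow [Fintype ι] (hq : 0 ≤ q) (ht : 0 ≤ t) :
    ConvexOn ℝ {x : ι → ℝ | ∀ i, 0 < x i} fun x => (∑ i, x i ^ (-q)) ^ t := by
  have hconvex : Convex ℝ {x : ι → ℝ | ∀ i, 0 < x i} := by
    simpa [Set.pi] using convex_pi fun (i : ι) (_ : i ∈ Set.univ) => convex_Ioi (𝕜 := ℝ) (0 : ℝ)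
  have hnonneg {x : ι → ℝ} (hx : ∀ i, 0 < x i) : 0 ≤ ∑ i, x i ^ (-q) :=
    Finset.sum_nonneg fun i _ => Real.rpow_nonneg (hx i).le _
  refine convexOn_iff_forall_pos.2 ⟨hconvex, fun x hx y hy a b ha hb hab => ?_⟩
  calc (∑ i, (a * x i + b * y i) ^ (-q)) ^ t
      ≤ ((∑ i, x i ^ (-q)) ^ a * (∑ i, y i ^ (-q)) ^ b) ^ t :=
        Real.rpow_le_rpow (hnonneg (hconvex hx hy ha.le hb.le hab))
          (sum_rpow_neg_le_mul hx hy ha hb hab hq) ht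
    _ = ((∑ i, x i ^ (-q)) ^ t) ^ a * ((∑ i, y i ^ (-q)) ^ t) ^ b := by
        rw [Real.mul_rpow (Real.rpow_nonneg (hnonneg hx) _) (Real.rpow_nonneg (hnonneg hy) _),
          rpow_right_comm (hnonneg hx), rpow_right_comm (hnonneg hy)]
    _ ≤ a * (∑ i, x i ^ (-q)) ^ t + b * (∑ i, y i ^ (-q)) ^ t :=
        Real.geom_mean_le_arith_mean2_weighted ha.le hb.le (Real.rpow_nonneg (hnonneg hx) _)
          (Real.rpow_nonneg (hnonneg hy) _) hab

end Convexity

section OrthogonalConjugation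

variable {ι κ : Type*} [Fintype ι]

theorem sum_sq_col_eq_one [DecidableEq κ] {U : Matrix ι κ ℝ} (hU : Uᵀ * U = 1) (j : κ) :
    ∑ i, U i j ^ 2 = 1 := by
  simpa [Matrix.mul_apply, sq] using congrFun (congrFun hU j) j

variable [DecidableEq ι]

theorem conj_diagonal_apply_self (U : Matrix ι κ ℝ) (d : ι → ℝ) (j : κ) :
    (Uᵀ * Matrix.diagonal d * U) j j = ∑ i, U i j ^ 2 • d i := by
  rw [Matrix.mul_apply]
  refine Finset.sum_congr rfl fun i _ => ?_
  rw [Matrix.mul_diagonal, Matrix.transpose_apply, smul_eq_mul]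
  ring

theorem conj_diagonal_apply_self_mem [DecidableEq κ] {U : Matrix ι κ ℝ} (hU : Uᵀ * U = 1)
    {s : Set ℝ} (hs : Convex ℝ s) {d : ι → ℝ} (hd : ∀ i, d i ∈ s) (j : κ) :
    (Uᵀ * Matrix.diagonal d * U) j j ∈ s := by
  rw [conj_diagonal_apply_self]
  exact hs.sum_mem (fun i _ => sq_nonneg _) (sum_sq_col_eq_one hU j) fun i _ => hd i

-- Peierls' inequality: the squared entries of an orthogonal matrix form a doubly stochastic matrix.
theorem sum_map_conj_diagonal_apply_self_le [Fintype κ] [DecidableEq κ] {U : Matrix ι κ ℝ}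
    (hU : Uᵀ * U = 1) (hU' : U * Uᵀ = 1) {s : Set ℝ} {f : ℝ → ℝ} (hf : ConvexOn ℝ s f)
    {d : ι → ℝ} (hd : ∀ i, d i ∈ s) :
    ∑ j, f ((Uᵀ * Matrix.diagonal d * U) j j) ≤ ∑ i, f (d i) := by
  have hrow (i : ι) : ∑ j, U i j ^ 2 = 1 :=
    sum_sq_col_eq_one (U := Uᵀ) (by rwa [Matrix.transpose_transpose]) i
  calc ∑ j, f ((Uᵀ * Matrix.diagonal d * U) j j)
      ≤ ∑ j, ∑ i, U i j ^ 2 • f (d i) := by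
        refine Finset.sum_le_sum fun j _ => ?_
        rw [conj_diagonal_apply_self]
        exact hf.map_sum_le (fun i _ => sq_nonneg _) (sum_sq_col_eq_one hU j) fun i _ => hd i
    _ = ∑ i, f (d i) := by
        rw [Finset.sum_comm]
        simp only [← Finset.sum_smul, hrow, one_smul]

end OrthogonalConjugation

section ReducedDiagonalization

variable {m ι κ : Type*} [Fintype m] [Fintype ι] [DecidableEq ι]

/-- A diagonalization of `A` on the range of an orthogonal projection `P` outside of which `A`
vanishes: the columns of `W` are an orthonormal basis of the range of `P` consisting of
eigenvectors of `A`, with eigenvalues `d`. The Laplacian matrices of connected graphs with `n` nodes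
share the projection `centering n`, so that they can be compared there as positive definite
matrices. -/
structure IsReducedDiagonalization (P A : Matrix m m ℝ) (W : Matrix m ι ℝ) (d : ι → ℝ) :
    Prop where
  transpose_mul : Wᵀ * W = 1
  mul_transpose : W * Wᵀ = P
  eq : A = W * Matrix.diagonal d * Wᵀ

namespace IsReducedDiagonalization

variable {P A A₁ A₂ : Matrix m m ℝ} {W : Matrix m ι ℝ} {W₁ : Matrix m ι ℝ} {W₂ : Matrix m κ ℝ}
  {d d₁ : ι → ℝ} {d₂ : κ → ℝ} {s : Set ℝ} {f : ℝ → ℝ}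

theorem transpose_mul_mul (h : IsReducedDiagonalization P A W d) :
    Wᵀ * A * W = Matrix.diagonal d := by
  calc Wᵀ * A * W = Wᵀ * W * Matrix.diagonal d * (Wᵀ * W) := by
        simp only [h.eq, Matrix.mul_assoc]
    _ = Matrix.diagonal d := by rw [h.transpose_mul, Matrix.one_mul, Matrix.mul_one]

theorem transpose_mul_mul_eq_conj (h₁ : IsReducedDiagonalization P A₁ W₁ d₁) (W₂ : Matrix m κ ℝ) :
    W₂ᵀ * A₁ * W₂ = (W₁ᵀ * W₂)ᵀ * Matrix.diagonal d₁ * (W₁ᵀ * W₂) := by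
  simp only [h₁.eq, Matrix.transpose_mul, Matrix.transpose_transpose, Matrix.mul_assoc]

variable [Fintype κ] [DecidableEq κ]

theorem transpose_mul_mul_transpose_mul (h₁ : IsReducedDiagonalization P A₁ W₁ d₁)
    (h₂ : IsReducedDiagonalization P A₂ W₂ d₂) : W₂ᵀ * W₁ * (W₁ᵀ * W₂) = 1 := by
  calc W₂ᵀ * W₁ * (W₁ᵀ * W₂) = W₂ᵀ * (W₁ * W₁ᵀ) * W₂ := by simp only [Matrix.mul_assoc]
    _ = W₂ᵀ * (W₂ * W₂ᵀ) * W₂ := by rw [h₁.mul_transpose, h₂.mul_transpose]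
    _ = W₂ᵀ * W₂ * (W₂ᵀ * W₂) := by simp only [Matrix.mul_assoc]
    _ = 1 := by rw [h₂.transpose_mul, Matrix.mul_one]

theorem compression_apply_self_mem (h₁ : IsReducedDiagonalization P A₁ W₁ d₁)
    (h₂ : IsReducedDiagonalization P A₂ W₂ d₂) (hs : Convex ℝ s) (hd₁ : ∀ i, d₁ i ∈ s) (j : κ) :
    (W₂ᵀ * A₁ * W₂) j j ∈ s := by
  rw [h₁.transpose_mul_mul_eq_conj]
  refine conj_diagonal_apply_self_mem ?_ hs hd₁ j
  rw [Matrix.transpose_mul, Matrix.transpose_transpose, h₁.transpose_mul_mul_transpose_mul h₂]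

theorem sum_map_compression_apply_self_le (h₁ : IsReducedDiagonalization P A₁ W₁ d₁)
    (h₂ : IsReducedDiagonalization P A₂ W₂ d₂) (hf : ConvexOn ℝ s f) (hd₁ : ∀ i, d₁ i ∈ s) :
    ∑ j, f ((W₂ᵀ * A₁ * W₂) j j) ≤ ∑ i, f (d₁ i) := by
  rw [h₁.transpose_mul_mul_eq_conj]
  refine sum_map_conj_diagonal_apply_self_le ?_ ?_ hf hd₁ <;>
    rw [Matrix.transpose_mul, Matrix.transpose_transpose]
  exacts [h₁.transpose_mul_mul_transpose_mul h₂, h₂.transpose_mul_mul_transpose_mul h₁]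

theorem sum_map_le_of_posSemidef (h₁ : IsReducedDiagonalization P A₁ W₁ d₁)
    (h₂ : IsReducedDiagonalization P A₂ W₂ d₂) (hle : (A₁ - A₂).PosSemidef)
    (hf : ConvexOn ℝ s f) (hanti : AntitoneOn f s) (hd₁ : ∀ i, d₁ i ∈ s) (hd₂ : ∀ i, d₂ i ∈ s) :
    ∑ i, f (d₁ i) ≤ ∑ i, f (d₂ i) := by
  have hdiag (i : ι) : (W₁ᵀ * A₂ * W₁) i i ≤ d₁ i := by
    have hnonneg : 0 ≤ (W₁ᵀ * (A₁ - A₂) * W₁) i i :=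
      (hle.conjTranspose_mul_mul_same W₁).diag_nonneg
    rw [Matrix.mul_sub, Matrix.sub_mul, h₁.transpose_mul_mul, Matrix.sub_apply,
      Matrix.diagonal_apply_eq] at hnonneg
    linarith
  calc ∑ i, f (d₁ i) ≤ ∑ i, f ((W₁ᵀ * A₂ * W₁) i i) := Finset.sum_le_sum fun i _ =>
        hanti (h₂.compression_apply_self_mem h₁ hf.1 hd₂ i) (hd₁ i) (hdiag i)
    _ ≤ ∑ i, f (d₂ i) := h₂.sum_map_compression_apply_self_le h₁ hf hd₂

theorem rpow_sum_rpow_neg_le {ι' : Type*} [Fintype ι'] [DecidableEq ι'] {W : Matrix m ι' ℝ}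
    {d : ι' → ℝ} {a b q t : ℝ} (h₁ : IsReducedDiagonalization P A₁ W₁ d₁)
    (h₂ : IsReducedDiagonalization P A₂ W₂ d₂)
    (h : IsReducedDiagonalization P (a • A₁ + b • A₂) W d) (hd₁ : ∀ i, 0 < d₁ i)
    (hd₂ : ∀ i, 0 < d₂ i) (ha : 0 ≤ a) (hb : 0 ≤ b) (hab : a + b = 1) (hq : 0 ≤ q) (ht : 0 ≤ t) :
    (∑ i, d i ^ (-q)) ^ t ≤ a * (∑ i, d₁ i ^ (-q)) ^ t + b * (∑ i, d₂ i ^ (-q)) ^ t := by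
  set x : ι' → ℝ := fun i => (Wᵀ * A₁ * W) i i
  set y : ι' → ℝ := fun i => (Wᵀ * A₂ * W) i i
  have hx (i : ι') : 0 < x i := h₁.compression_apply_self_mem h (convex_Ioi 0) hd₁ i
  have hy (i : ι') : 0 < y i := h₂.compression_apply_self_mem h (convex_Ioi 0) hd₂ i
  have hd : d = a • x + b • y := by
    ext i
    rw [← Matrix.diagonal_apply_eq d i, ← h.transpose_mul_mul]
    simp [x, y, Matrix.mul_add, Matrix.add_mul]
  calc (∑ i, d i ^ (-q)) ^ t
      ≤ a * (∑ i, x i ^ (-q)) ^ t + b * (∑ i, y i ^ (-q)) ^ t := by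
        rw [hd]
        exact (convexOn_sum_rpow_neg_rpow hq ht).2 hx hy ha hb hab
    _ ≤ a * (∑ i, d₁ i ^ (-q)) ^ t + b * (∑ i, d₂ i ^ (-q)) ^ t := by
        gcongr
        · exact Finset.sum_nonneg fun i _ => Real.rpow_nonneg (hx i).le _
        · exact h₁.sum_map_compression_apply_self_le h (convexOn_rpow_neg hq) hd₁
        · exact Finset.sum_nonneg fun i _ => Real.rpow_nonneg (hy i).le _
        · exact h₂.sum_map_compression_apply_self_le h (convexOn_rpow_neg hq) hd₂

end IsReducedDiagonalization

end ReducedDiagonalization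

section Laplacian

variable {n : ℕ} {K K₁ K₂ : Matrix (Fin n) (Fin n) ℝ}

theorem laplacian_mulVec_apply (K : Matrix (Fin n) (Fin n) ℝ) (x : Fin n → ℝ) (i : Fin n) :
    (laplacian K *ᵥ x) i = ∑ j, K i j * (x i - x j) := by
  rw [laplacian, Matrix.sub_mulVec, Pi.sub_apply, Matrix.mulVec_diagonal, Finset.sum_mul,
    Matrix.mulVec, dotProduct, ← Finset.sum_sub_distrib]
  exact Finset.sum_congr rfl fun j _ => (mul_sub _ _ _).symm

theorem laplacian_mulVec_one (K : Matrix (Fin n) (Fin n) ℝ) : laplacian K *ᵥ 1 = 0 := by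
  ext i
  simp [laplacian_mulVec_apply]

theorem two_mul_dotProduct_laplacian_mulVec (hK : ∀ i j, K i j = K j i) (x : Fin n → ℝ) :
    2 * (x ⬝ᵥ laplacian K *ᵥ x) = ∑ i, ∑ j, K i j * (x i - x j) ^ 2 := by
  have hexpand : x ⬝ᵥ laplacian K *ᵥ x = ∑ i, ∑ j, K i j * (x i * (x i - x j)) := by
    simp only [dotProduct, laplacian_mulVec_apply, Finset.mul_sum, mul_left_comm]
  have hswap : x ⬝ᵥ laplacian K *ᵥ x = ∑ i, ∑ j, K i j * (x j * (x j - x i)) := by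
    rw [hexpand, Finset.sum_comm]
    simp only [hK]
  calc 2 * (x ⬝ᵥ laplacian K *ᵥ x)
      = ∑ i, ∑ j, K i j * (x i * (x i - x j)) + ∑ i, ∑ j, K i j * (x j * (x j - x i)) := by
        rw [← hexpand, ← hswap, two_mul]
    _ = ∑ i, ∑ j, K i j * (x i - x j) ^ 2 := by
        simp only [← Finset.sum_add_distrib]
        exact Finset.sum_congr rfl fun i _ => Finset.sum_congr rfl fun j _ => by ring

theorem laplacian_combination (K₁ K₂ : Matrix (Fin n) (Fin n) ℝ) (a b : ℝ) :
    a • laplacian K₁ + b • laplacian K₂ = laplacian (a • K₁ + b • K₂) := by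
  ext i j
  simp only [laplacian, Matrix.add_apply, Matrix.sub_apply, Matrix.smul_apply, smul_eq_mul,
    Matrix.diagonal_apply, Finset.sum_add_distrib, ← Finset.mul_sum]
  split_ifs <;> ring

namespace IsFeedbackGain

theorem neZero (hK : IsFeedbackGain K) : NeZero n :=
  ⟨(Fin.pos_iff_nonempty.2 hK.connected.nonempty).ne'⟩

theorem dotProduct_laplacian_mulVec_nonneg (hK : IsFeedbackGain K) (x : Fin n → ℝ) :
    0 ≤ x ⬝ᵥ laplacian K *ᵥ x := by
  have hsum : 0 ≤ ∑ i, ∑ j, K i j * (x i - x j) ^ 2 :=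
    Finset.sum_nonneg fun i _ => Finset.sum_nonneg fun j _ =>
      mul_nonneg (hK.nonneg i j) (sq_nonneg _)
  linarith [two_mul_dotProduct_laplacian_mulVec hK.symm x]

theorem mul_sq_sub_eq_zero (hK : IsFeedbackGain K) {x : Fin n → ℝ}
    (hx : x ⬝ᵥ laplacian K *ᵥ x = 0) (i j : Fin n) : K i j * (x i - x j) ^ 2 = 0 := by
  have hnonneg (i j : Fin n) : 0 ≤ K i j * (x i - x j) ^ 2 :=
    mul_nonneg (hK.nonneg i j) (sq_nonneg _)
  have hsum : ∑ i, ∑ j, K i j * (x i - x j) ^ 2 = 0 := by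
    rw [← two_mul_dotProduct_laplacian_mulVec hK.symm, hx, mul_zero]
  rw [Fintype.sum_eq_zero_iff_of_nonneg fun i => Finset.sum_nonneg fun j _ => hnonneg i j] at hsum
  exact congrFun ((Fintype.sum_eq_zero_iff_of_nonneg (hnonneg i)).1 (congrFun hsum i)) j

theorem eq_of_dotProduct_laplacian_mulVec_eq_zero (hK : IsFeedbackGain K) {x : Fin n → ℝ}
    (hx : x ⬝ᵥ laplacian K *ᵥ x = 0) (i j : Fin n) : x i = x j := by
  have hadj {i j : Fin n} (hij : (couplingGraph K).Adj i j) : x i = x j := by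
    rw [couplingGraph, SimpleGraph.fromRel_adj] at hij
    have hKij : K i j ≠ 0 := hij.2.elim id fun h => by rwa [hK.symm]
    have hsq := (mul_eq_zero.1 (hK.mul_sq_sub_eq_zero hx i j)).resolve_left hKij
    exact sub_eq_zero.1 (sq_eq_zero_iff.1 hsq)
  obtain ⟨walk⟩ := hK.connected.preconnected i j
  induction walk with
  | nil => rfl
  | cons h _ ih => exact (hadj h).trans ih

theorem combination (h₁ : IsFeedbackGain K₁) (h₂ : IsFeedbackGain K₂) {a b : ℝ} (ha : 0 < a)
    (hb : 0 ≤ b) : IsFeedbackGain (a • K₁ + b • K₂) where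
  nonneg i j := add_nonneg (mul_nonneg ha.le (h₁.nonneg i j)) (mul_nonneg hb (h₂.nonneg i j))
  symm i j := by simp [h₁.symm i j, h₂.symm i j]
  simple i := by simp [h₁.simple i, h₂.simple i]
  connected := by
    have hne (i j : Fin n) (h : K₁ i j ≠ 0) : (a • K₁ + b • K₂) i j ≠ 0 :=
      (add_pos_of_pos_of_nonneg (mul_pos ha ((h₁.nonneg i j).lt_of_ne' h))
        (mul_nonneg hb (h₂.nonneg i j))).ne'
    refine h₁.connected.mono fun i j hij => ?_
    rw [couplingGraph, SimpleGraph.fromRel_adj] at hij ⊢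
    exact ⟨hij.1, hij.2.imp (hne i j) (hne j i)⟩

end IsFeedbackGain

theorem convex_laplacians : Convex ℝ (laplacians n) := by
  refine convex_iff_forall_pos.2 ?_
  rintro _ ⟨K₁, h₁, rfl⟩ _ ⟨K₂, h₂, rfl⟩ a b ha hb -
  exact ⟨a • K₁ + b • K₂, h₁.combination h₂ ha hb.le, laplacian_combination K₁ K₂ a b⟩

end Laplacian

section Eigenvalues

variable {n : ℕ} {A B K L : Matrix (Fin n) (Fin n) ℝ}

theorem eigenvalue_monotone (hA : A.IsHermitian) : Monotone (eigenvalue hA) := fun _ _ hij =>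
  hA.eigenvalues₀_antitone (by simpa using Fin.rev_le_rev.2 hij)

theorem eigenvalue_eq_of_charpoly_eq (hA : A.IsHermitian) (hB : B.IsHermitian)
    (h : A.charpoly = B.charpoly) : eigenvalue hA = eigenvalue hB := by
  have heq : hA.eigenvalues₀ = hB.eigenvalues₀ := by
    simp_rw [← List.ofFn_inj, ← Matrix.IsHermitian.sort_roots_charpoly_eq_eigenvalues₀, h]
  ext i
  simp only [eigenvalue, heq]

theorem exists_eigenvalue_eq_eigenvalues_comp (hA : A.IsHermitian) :
    ∃ e : Fin n ≃ Fin n, eigenvalue hA = hA.eigenvalues ∘ e := by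
  refine ⟨(Fin.revPerm.trans (finCongr (Fintype.card_fin n).symm)).trans
    (Fintype.equivOfCardEq (Fintype.card_fin _)), ?_⟩
  ext i
  simp [eigenvalue, Matrix.IsHermitian.eigenvalues]

theorem exists_isReducedDiagonalization_one (hA : A.IsHermitian) :
    ∃ V : Matrix (Fin n) (Fin n) ℝ, IsReducedDiagonalization 1 A V (eigenvalue hA) := by
  obtain ⟨e, he⟩ := exists_eigenvalue_eq_eigenvalues_comp hA
  set U : Matrix (Fin n) (Fin n) ℝ := hA.eigenvectorUnitary.val
  have hU : Uᵀ * U = 1 := Unitary.coe_star_mul_self hA.eigenvectorUnitary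
  have hspectral : A = U * Matrix.diagonal hA.eigenvalues * Uᵀ :=
    hA.spectral_theorem.trans (Unitary.conjStarAlgAut_apply _ _)
  refine ⟨U.submatrix id e, ?_, ?_, ?_⟩
  · rw [Matrix.transpose_submatrix, ← Matrix.submatrix_mul _ _ _ _ _ Function.bijective_id, hU,
      Matrix.submatrix_one_equiv]
  · rw [Matrix.transpose_submatrix, Matrix.submatrix_mul_equiv, mul_eq_one_comm.1 hU,
      Matrix.submatrix_id_id]
  · rw [he, ← Matrix.submatrix_diagonal_equiv, Matrix.transpose_submatrix,
      Matrix.submatrix_mul_equiv, Matrix.submatrix_mul_equiv, Matrix.submatrix_id_id, ← hspectral]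

namespace IsReducedDiagonalization

variable {ι : Type*} [Fintype ι] [DecidableEq ι] {P : Matrix (Fin n) (Fin n) ℝ}
  {W : Matrix (Fin n) ι ℝ} {d : ι → ℝ} {i j : ι}

theorem dotProduct_mulVec_col (h : IsReducedDiagonalization P A W d) (i : ι) :
    W.col i ⬝ᵥ A *ᵥ W.col i = d i := by
  rw [← Matrix.diagonal_apply_eq d i, ← h.transpose_mul_mul, Matrix.mul_assoc]
  rfl

theorem eigenvalue_nonneg (h : IsReducedDiagonalization P (laplacian K) W d)
    (hK : IsFeedbackGain K) (i : ι) : 0 ≤ d i :=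
  h.dotProduct_mulVec_col i ▸ hK.dotProduct_laplacian_mulVec_nonneg _

theorem apply_eq_of_eigenvalue_eq_zero (h : IsReducedDiagonalization P (laplacian K) W d)
    (hK : IsFeedbackGain K) (hi : d i = 0) (k l : Fin n) : W k i = W l i :=
  hK.eq_of_dotProduct_laplacian_mulVec_eq_zero ((h.dotProduct_mulVec_col i).trans hi) k l

theorem natCast_mul_mul_eq_one_apply (h : IsReducedDiagonalization P (laplacian K) W d)
    (hK : IsFeedbackGain K) (hi : d i = 0) (hj : d j = 0) (k l : Fin n) :
    n * (W k i * W l j) = (1 : Matrix ι ι ℝ) i j := by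
  rw [← h.transpose_mul, Matrix.mul_apply]
  simp [h.apply_eq_of_eigenvalue_eq_zero hK hi _ k, h.apply_eq_of_eigenvalue_eq_zero hK hj _ l]

theorem eq_of_eigenvalue_eq_zero (h : IsReducedDiagonalization P (laplacian K) W d)
    (hK : IsFeedbackGain K) (hi : d i = 0) (hj : d j = 0) : i = j := by
  have := hK.neZero
  by_contra hij
  have hii := h.natCast_mul_mul_eq_one_apply hK hi hi 0 0
  have hjj := h.natCast_mul_mul_eq_one_apply hK hj hj 0 0
  have hzero := h.natCast_mul_mul_eq_one_apply hK hi hj 0 0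
  rw [Matrix.one_apply_eq] at hii hjj
  rw [Matrix.one_apply_ne hij] at hzero
  have hmul : W 0 i * W 0 j = 0 := (mul_eq_zero.1 hzero).resolve_left (NeZero.ne _)
  rcases mul_eq_zero.1 hmul with h0 | h0 <;> simp_all

theorem exists_eigenvalue_eq_zero (h : IsReducedDiagonalization 1 (laplacian K) W d)
    (hK : IsFeedbackGain K) : ∃ i, d i = 0 := by
  have := hK.neZero
  by_contra! hd
  have hker : Matrix.diagonal d *ᵥ (Wᵀ *ᵥ 1) = 0 := by
    rw [← h.transpose_mul_mul, Matrix.mulVec_mulVec, Matrix.mul_assoc, h.mul_transpose,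
      Matrix.mul_one, ← Matrix.mulVec_mulVec, laplacian_mulVec_one, Matrix.mulVec_zero]
  have hzero : Wᵀ *ᵥ 1 = 0 := by
    ext i
    have hi := congrFun hker i
    rw [Matrix.mulVec_diagonal] at hi
    exact (mul_eq_zero.1 hi).resolve_left (hd i)
  have hone : W *ᵥ (Wᵀ *ᵥ 1) = 1 := by
    rw [Matrix.mulVec_mulVec, h.mul_transpose, Matrix.one_mulVec]
  rw [hzero, Matrix.mulVec_zero] at hone
  simpa using congrFun hone 0

end IsReducedDiagonalization

theorem eigenvalue_pos (hL : L ∈ laplacians n) {i : Fin n} (hi : 0 < (i : ℕ)) :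
    0 < eigenvalue (isHermitian_of_mem_laplacians hL) i := by
  obtain ⟨V, hV⟩ := exists_isReducedDiagonalization_one (isHermitian_of_mem_laplacians hL)
  have hmono := eigenvalue_monotone (isHermitian_of_mem_laplacians hL)
  obtain ⟨K, hK, rfl⟩ := hL
  have := hK.neZero
  refine (hV.eigenvalue_nonneg hK i).lt_of_ne' fun hdi => ?_
  have hd0 := le_antisymm (hdi ▸ hmono (Fin.zero_le i)) (hV.eigenvalue_nonneg hK 0)
  exact hi.ne (congrArg Fin.val (hV.eq_of_eigenvalue_eq_zero hK hd0 hdi))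

theorem eigenvalue_zero [NeZero n] (hL : L ∈ laplacians n) :
    eigenvalue (isHermitian_of_mem_laplacians hL) 0 = 0 := by
  obtain ⟨V, hV⟩ := exists_isReducedDiagonalization_one (isHermitian_of_mem_laplacians hL)
  obtain ⟨i, hi⟩ : ∃ i, eigenvalue (isHermitian_of_mem_laplacians hL) i = 0 := by
    obtain ⟨K, hK, rfl⟩ := hL
    exact hV.exists_eigenvalue_eq_zero hK
  rcases Nat.eq_zero_or_pos i with hi0 | hpos
  · rwa [← Fin.val_eq_zero_iff.1 hi0]
  · exact absurd hi (eigenvalue_pos hL hpos).ne'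

theorem sum_eq_zero_add_sum_pos [NeZero n] {M : Type*} [AddCommMonoid M] (f : Fin n → M) :
    ∑ i, f i = f 0 + ∑ i : {i : Fin n // 0 < (i : ℕ)}, f i := by
  rw [← Finset.add_sum_erase _ f (Finset.mem_univ 0),
    Finset.sum_subtype (p := fun i : Fin n => 0 < (i : ℕ)) _ fun i => by
      simp [Nat.pos_iff_ne_zero]]

theorem exists_isReducedDiagonalization_centering (hL : L ∈ laplacians n) :
    ∃ W : Matrix (Fin n) {i : Fin n // 0 < (i : ℕ)} ℝ, IsReducedDiagonalization (centering n) L W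
      fun i => eigenvalue (isHermitian_of_mem_laplacians hL) i := by
  obtain ⟨V, hV⟩ := exists_isReducedDiagonalization_one (isHermitian_of_mem_laplacians hL)
  have : NeZero n := hL.choose_spec.1.neZero
  have hzero := eigenvalue_zero hL
  have hV₀ (k l : Fin n) : V k 0 * V l 0 = 1 / n := by
    obtain ⟨K, hK, rfl⟩ := hL
    have hone := hV.natCast_mul_mul_eq_one_apply hK hzero hzero k l
    rw [Matrix.one_apply_eq] at hone
    rwa [eq_div_iff (NeZero.ne _), mul_comm]
  refine ⟨V.submatrix id Subtype.val, ?_, ?_, ?_⟩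
  · rw [Matrix.transpose_submatrix, ← Matrix.submatrix_mul _ _ _ _ _ Function.bijective_id,
      hV.transpose_mul, Matrix.submatrix_one _ Subtype.val_injective]
  · ext k l
    have hkl := congrFun (congrFun hV.mul_transpose k) l
    rw [Matrix.mul_apply, sum_eq_zero_add_sum_pos] at hkl
    simp [Matrix.mul_apply, centering, ← hkl, hV₀]
  · ext k l
    have hkl := congrFun (congrFun hV.eq k) l
    rw [Matrix.mul_apply, sum_eq_zero_add_sum_pos] at hkl
    rw [Matrix.mul_apply]
    simpa [Matrix.mul_diagonal, hzero] using hkl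

end Eigenvalues

section SpectralPowerSum

variable {n : ℕ} {L L₁ L₂ : Matrix (Fin n) (Fin n) ℝ} {a b c q t : ℝ}

/-- The sum `∑ λ_i ^ (-q)` over all the eigenvalues of a symmetric matrix except the smallest one,
that is, the `q`-th power of the spectral zeta function of order `q`. -/
noncomputable def spectralPowerSum (hL : L.IsHermitian) (q : ℝ) : ℝ :=
  ∑ i : {i : Fin n // 0 < (i : ℕ)}, eigenvalue hL i ^ (-q)

theorem spectralPowerSum_nonneg (hL : L ∈ laplacians n) (q : ℝ) :
    0 ≤ spectralPowerSum (isHermitian_of_mem_laplacians hL) q :=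
  Finset.sum_nonneg fun i _ => Real.rpow_nonneg (eigenvalue_pos hL i.2).le _

theorem spectralPowerSum_anti (h₁ : L₁ ∈ laplacians n) (h₂ : L₂ ∈ laplacians n)
    (hle : (L₁ - L₂).PosSemidef) (hq : 0 ≤ q) :
    spectralPowerSum (isHermitian_of_mem_laplacians h₁) q ≤
      spectralPowerSum (isHermitian_of_mem_laplacians h₂) q := by
  obtain ⟨W₁, hW₁⟩ := exists_isReducedDiagonalization_centering h₁
  obtain ⟨W₂, hW₂⟩ := exists_isReducedDiagonalization_centering h₂
  exact hW₁.sum_map_le_of_posSemidef hW₂ hle (convexOn_rpow_neg hq) (antitoneOn_rpow_neg hq)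
    (fun i => eigenvalue_pos h₁ i.2) fun i => eigenvalue_pos h₂ i.2

theorem spectralPowerSum_combination_rpow_le (h₁ : L₁ ∈ laplacians n) (h₂ : L₂ ∈ laplacians n)
    (h : a • L₁ + b • L₂ ∈ laplacians n) (ha : 0 ≤ a) (hb : 0 ≤ b) (hab : a + b = 1) (hq : 0 ≤ q)
    (ht : 0 ≤ t) :
    spectralPowerSum (isHermitian_of_mem_laplacians h) q ^ t ≤
      a * spectralPowerSum (isHermitian_of_mem_laplacians h₁) q ^ t +
        b * spectralPowerSum (isHermitian_of_mem_laplacians h₂) q ^ t := by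
  obtain ⟨W₁, hW₁⟩ := exists_isReducedDiagonalization_centering h₁
  obtain ⟨W₂, hW₂⟩ := exists_isReducedDiagonalization_centering h₂
  obtain ⟨W, hW⟩ := exists_isReducedDiagonalization_centering h
  exact hW₁.rpow_sum_rpow_neg_le hW₂ hW (fun i => eigenvalue_pos h₁ i.2)
    (fun i => eigenvalue_pos h₂ i.2) ha hb hab hq ht

theorem spectralPowerSum_conj {U : Matrix (Fin n) (Fin n) ℝ}
    (hU : U ∈ Matrix.orthogonalGroup (Fin n) ℝ) (hL : L.IsHermitian)
    (hL' : (U * L * Uᵀ).IsHermitian) (q : ℝ) :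
    spectralPowerSum hL' q = spectralPowerSum hL q := by
  have hcharpoly : (U * L * Uᵀ).charpoly = L.charpoly := by
    have hUU : Uᵀ * U = 1 := Unitary.star_mul_self_of_mem hU
    rw [Matrix.charpoly_mul_comm, ← Matrix.mul_assoc, hUU, Matrix.one_mul]
  rw [spectralPowerSum, eigenvalue_eq_of_charpoly_eq hL' hL hcharpoly, spectralPowerSum]

namespace IsSystemicPerformanceMeasure

theorem of_eq_mul_spectralPowerSum_rpow {ρ : Matrix (Fin n) (Fin n) ℝ → ℝ} (hc : 0 ≤ c)
    (hq : 0 ≤ q) (ht : 0 ≤ t)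
    (hρ : ∀ L (hL : L ∈ laplacians n),
      ρ L = c * spectralPowerSum (isHermitian_of_mem_laplacians hL) q ^ t) :
    IsSystemicPerformanceMeasure ρ where
  monotone L₁ h₁ L₂ h₂ hle := by
    rw [hρ L₁ h₁, hρ L₂ h₂]
    gcongr
    · exact spectralPowerSum_nonneg h₁ q
    · exact spectralPowerSum_anti h₁ h₂ hle hq
  convex := by
    refine ⟨convex_laplacians, fun L₁ h₁ L₂ h₂ a b ha hb hab => ?_⟩
    have h := convex_laplacians h₁ h₂ ha hb hab
    rw [hρ L₁ h₁, hρ L₂ h₂, hρ _ h, smul_eq_mul, smul_eq_mul, mul_left_comm a, mul_left_comm b,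
      ← mul_add]
    gcongr
    exact spectralPowerSum_combination_rpow_le h₁ h₂ h ha hb hab hq ht
  orthogonal_invariant L hL U hU hL' := by
    rw [hρ L hL, hρ _ hL', spectralPowerSum_conj hU (isHermitian_of_mem_laplacians hL)]

theorem of_tendsto {ι : Type*} {l : Filter ι} [l.NeBot]
    {ρ : ι → Matrix (Fin n) (Fin n) ℝ → ℝ} {ρ' : Matrix (Fin n) (Fin n) ℝ → ℝ}
    (hρ : ∀ᶠ r in l, IsSystemicPerformanceMeasure (ρ r))
    (hlim : ∀ L ∈ laplacians n, Tendsto (fun r => ρ r L) l (𝓝 (ρ' L))) :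
    IsSystemicPerformanceMeasure ρ' where
  monotone L₁ h₁ L₂ h₂ hle := le_of_tendsto_of_tendsto (hlim L₁ h₁) (hlim L₂ h₂)
    (hρ.mono fun _ h => h.monotone L₁ h₁ L₂ h₂ hle)
  convex := ⟨convex_laplacians, fun L₁ h₁ L₂ h₂ _ _ ha hb hab =>
    le_of_tendsto_of_tendsto (hlim _ (convex_laplacians h₁ h₂ ha hb hab))
      (((hlim L₁ h₁).const_smul _).add ((hlim L₂ h₂).const_smul _))
      (hρ.mono fun _ h => h.convex.2 h₁ h₂ ha hb hab)⟩
  orthogonal_invariant L hL U hU hL' := tendsto_nhds_unique_of_eventuallyEq (hlim L hL)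
    (hlim _ hL') (hρ.mono fun _ h => h.orthogonal_invariant L hL U hU hL')

end IsSystemicPerformanceMeasure

end SpectralPowerSum

section SingularValues

variable {n : ℕ} {ι : Type*} [Fintype ι] [DecidableEq ι] {U : Matrix (Fin n) ι ℂ} {g : ι → ℂ}

theorem singularValue_nonneg (G : Matrix (Fin n) (Fin n) ℂ) (k : ℕ) : 0 ≤ singularValue G k :=
  LinearMap.singularValues_nonneg _ k

theorem roots_charpoly_conjTranspose_mul_self (G : Matrix (Fin n) (Fin n) ℂ) :
    (Gᴴ * G).charpoly.roots =
      Finset.univ.val.map fun k : Fin n => ((singularValue G k ^ 2 : ℝ) : ℂ) := by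
  set T := Matrix.toEuclideanLin G with hT
  have hcharpoly : (LinearMap.adjoint T ∘ₗ T).charpoly = (Gᴴ * G).charpoly := by
    rw [hT, ← Matrix.toEuclideanLin_conjTranspose_eq_adjoint, Matrix.toEuclideanLin,
      ← Matrix.toLpLin_mul_same, Matrix.toLpLin_eq_toLin, Matrix.charpoly_toLin]
  rw [← hcharpoly, T.isSymmetric_adjoint_comp_self.roots_charpoly_eq_eigenvalues
    (finrank_euclideanSpace_fin (𝕜 := ℂ) (n := n))]
  refine Multiset.map_congr rfl fun k _ => ?_
  rw [singularValue, T.sq_singularValues_fin finrank_euclideanSpace_fin]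
  rfl

theorem roots_charpoly_mul_diagonal_mul (hU : Uᴴ * U = 1) (d : ι → ℂ) :
    Multiset.replicate (Fintype.card ι) 0 + (U * Matrix.diagonal d * Uᴴ).charpoly.roots =
      Multiset.replicate n 0 + Finset.univ.val.map d := by
  have hcharpoly := congrArg Polynomial.roots
    (Matrix.charpoly_mul_comm' (U * Matrix.diagonal d) Uᴴ)
  have hmonic (m : ℕ) : (Polynomial.X ^ m : Polynomial ℂ) ≠ 0 := (Polynomial.monic_X_pow m).ne_zero
  rw [← Matrix.mul_assoc, hU, Matrix.one_mul, Matrix.charpoly_diagonal,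
    Polynomial.roots_mul (mul_ne_zero (hmonic _) (Matrix.charpoly_monic _).ne_zero),
    Polynomial.roots_mul (mul_ne_zero (hmonic _)
      (Polynomial.monic_prod_X_sub_C d Finset.univ).ne_zero),
    Polynomial.roots_X_pow, Polynomial.roots_X_pow, Fintype.card_fin,
    Polynomial.roots_prod _ _ (Polynomial.monic_prod_X_sub_C d Finset.univ).ne_zero] at hcharpoly
  simpa only [Multiset.nsmul_singleton, Polynomial.roots_X_sub_C, Multiset.bind_singleton]
    using hcharpoly

theorem conjTranspose_mul_self_mul_diagonal_mul (hU : Uᴴ * U = 1) (g : ι → ℂ) :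
    (U * Matrix.diagonal g * Uᴴ)ᴴ * (U * Matrix.diagonal g * Uᴴ) =
      U * Matrix.diagonal (fun i => ((‖g i‖ ^ 2 : ℝ) : ℂ)) * Uᴴ := by
  calc (U * Matrix.diagonal g * Uᴴ)ᴴ * (U * Matrix.diagonal g * Uᴴ)
      = U * (Matrix.diagonal (star g) * (Uᴴ * U) * Matrix.diagonal g) * Uᴴ := by
        simp only [Matrix.conjTranspose_mul, Matrix.conjTranspose_conjTranspose,
          Matrix.diagonal_conjTranspose, Matrix.mul_assoc]
    _ = U * Matrix.diagonal (fun i => ((‖g i‖ ^ 2 : ℝ) : ℂ)) * Uᴴ := by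
        rw [hU, Matrix.mul_one, Matrix.diagonal_mul_diagonal]
        simp [Complex.conj_mul']

-- Zeros are padded on both sides because `U` need not be square.
theorem replicate_add_map_singularValue (hU : Uᴴ * U = 1) (g : ι → ℂ) :
    Multiset.replicate (Fintype.card ι) 0 + Finset.univ.val.map
        (fun k : Fin n => singularValue (U * Matrix.diagonal g * Uᴴ) k) =
      Multiset.replicate n 0 + Finset.univ.val.map fun i => ‖g i‖ := by
  have hroots := roots_charpoly_mul_diagonal_mul hU fun i => ((‖g i‖ ^ 2 : ℝ) : ℂ)
  rw [← conjTranspose_mul_self_mul_diagonal_mul hU, roots_charpoly_conjTranspose_mul_self]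
    at hroots
  have hsqrt := congrArg (Multiset.map fun z : ℂ => √z.re) hroots
  simpa only [Multiset.map_add, Multiset.map_replicate, Multiset.map_map, Function.comp_def,
    Complex.zero_re, Complex.ofReal_re, Real.sqrt_zero, Real.sqrt_sq (norm_nonneg _),
    Real.sqrt_sq (singularValue_nonneg _ _)] using hsqrt

theorem sum_map_singularValue {M : Type*} [AddCommMonoid M] (hU : Uᴴ * U = 1) (g : ι → ℂ)
    {F : ℝ → M} (hF : F 0 = 0) :
    ∑ k : Fin n, F (singularValue (U * Matrix.diagonal g * Uᴴ) k) = ∑ i, F ‖g i‖ := by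
  have hsum := congrArg (fun s => (s.map F).sum) (replicate_add_map_singularValue hU g)
  simpa [hF, Function.comp_def, List.sum_ofFn] using hsum

theorem ofReal_singularValue_zero (hU : Uᴴ * U = 1) (g : ι → ℂ) :
    ENNReal.ofReal (singularValue (U * Matrix.diagonal g * Uᴴ) 0) = ⨆ i, ‖g i‖ₑ := by
  set G := U * Matrix.diagonal g * Uᴴ
  have hmem (x : ℝ) (hx : x ≠ 0) : (∃ k : Fin n, singularValue G k = x) ↔ ∃ i, ‖g i‖ = x := by
    simpa [Multiset.mem_replicate, hx] using
      congrArg (x ∈ ·) (replicate_add_map_singularValue hU g)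
  refine le_antisymm ?_ (iSup_le fun i => ?_)
  · rcases eq_or_ne (singularValue G 0) 0 with hzero | hne
    · simp [hzero]
    · have hn : 0 < n := by
        by_contra! hn
        exact hne (LinearMap.singularValues_of_finrank_le _ (by simpa using hn))
      obtain ⟨i, hi⟩ := (hmem _ hne).1 ⟨⟨0, hn⟩, rfl⟩
      rw [← hi, ofReal_norm]
      exact le_iSup (fun i => ‖g i‖ₑ) i
  · rcases eq_or_ne ‖g i‖ 0 with hzero | hne
    · simp [norm_eq_zero.1 hzero]
    · obtain ⟨k, hk⟩ := (hmem _ hne).2 ⟨i, rfl⟩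
      rw [← ofReal_norm, ← hk]
      exact ENNReal.ofReal_le_ofReal (LinearMap.singularValues_antitone _ (Nat.zero_le _))

end SingularValues

section TransferMatrix

theorem mul_mul_inv_smul_one_add_mul_diagonal_mul {𝕜 m ι : Type*} [Field 𝕜] [Fintype m]
    [DecidableEq m] [Fintype ι] [DecidableEq ι] {W : Matrix m ι 𝕜} {W' : Matrix ι m 𝕜} {s : 𝕜}
    {d : ι → 𝕜} (hW : W' * W = 1) (hs : s ≠ 0) (hd : ∀ i, s + d i ≠ 0) :
    W * W' * (s • 1 + W * Matrix.diagonal d * W')⁻¹ =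
      W * Matrix.diagonal (fun i => (s + d i)⁻¹) * W' := by
  set A := s • 1 + W * Matrix.diagonal d * W' with hA
  set E := Matrix.diagonal fun i => (s + d i)⁻¹ with hE
  have hAW : A * W = W * Matrix.diagonal fun i => s + d i := by
    have hadd : (Matrix.diagonal fun i => s + d i) = s • 1 + Matrix.diagonal d := by
      rw [Matrix.smul_one_eq_diagonal, Matrix.diagonal_add]
    rw [hA, hadd, Matrix.add_mul, Matrix.mul_assoc _ W', hW, Matrix.mul_add]
    simp
  have hrange : A * (W * E * W') = W * W' := by
    rw [Matrix.mul_assoc W, ← Matrix.mul_assoc A, hAW, Matrix.mul_assoc, ← Matrix.mul_assoc _ E,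
      hE, Matrix.diagonal_mul_diagonal]
    simp [mul_inv_cancel₀ (hd _)]
  have hcompl : A * (1 - W * W') = s • (1 - W * W') := by
    rw [hA, Matrix.add_mul, Matrix.mul_assoc _ W', Matrix.mul_sub W', ← Matrix.mul_assoc W', hW]
    simp
  have hinv : A⁻¹ = W * E * W' + s⁻¹ • (1 - W * W') := by
    refine Matrix.inv_eq_right_inv ?_
    rw [Matrix.mul_add, hrange, Matrix.mul_smul, hcompl, inv_smul_smul₀ hs, add_sub_cancel]
  rw [hinv, Matrix.mul_add, Matrix.mul_smul, Matrix.mul_sub, Matrix.mul_assoc W W' (W * W'),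
    ← Matrix.mul_assoc W' W, Matrix.mul_assoc W W' (W * E * W'), Matrix.mul_assoc W E,
    ← Matrix.mul_assoc W' W, hW]
  simp

theorem conjTranspose_map_ofReal {m ι : Type*} (W : Matrix m ι ℝ) :
    (W.map Complex.ofReal)ᴴ = Wᵀ.map Complex.ofReal := by
  ext i j
  simp

theorem map_ofReal_mul {l m ι : Type*} [Fintype m] (A : Matrix l m ℝ) (B : Matrix m ι ℝ) :
    (A * B).map Complex.ofReal = A.map Complex.ofReal * B.map Complex.ofReal :=
  Matrix.map_mul (f := Complex.ofRealHom)

theorem map_ofReal_one {m : Type*} [DecidableEq m] :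
    (1 : Matrix m m ℝ).map Complex.ofReal = 1 :=
  Matrix.map_one _ Complex.ofReal_zero Complex.ofReal_one

namespace IsReducedDiagonalization

variable {n : ℕ} {ι : Type*} [Fintype ι] [DecidableEq ι] {P L : Matrix (Fin n) (Fin n) ℝ}
  {W : Matrix (Fin n) ι ℝ} {d : ι → ℝ} {s : ℂ}

theorem conjTranspose_map_ofReal_mul (h : IsReducedDiagonalization P L W d) :
    (W.map Complex.ofReal)ᴴ * W.map Complex.ofReal = 1 := by
  rw [conjTranspose_map_ofReal, ← map_ofReal_mul, h.transpose_mul, map_ofReal_one]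

theorem transferMatrix_eq (h : IsReducedDiagonalization P L W d) (hs : s ≠ 0)
    (hd : ∀ i, s + d i ≠ 0) :
    transferMatrix (-L) 1 P s = W.map Complex.ofReal *
      Matrix.diagonal (fun i => (s + d i)⁻¹) * (W.map Complex.ofReal)ᴴ := by
  have hneg : s • 1 - (-L).map Complex.ofReal = s • 1 + W.map Complex.ofReal *
      Matrix.diagonal (fun i => (d i : ℂ)) * (W.map Complex.ofReal)ᴴ := by
    rw [Matrix.map_neg _ Complex.ofReal_neg, sub_neg_eq_add, h.eq, map_ofReal_mul,
      map_ofReal_mul, conjTranspose_map_ofReal, Matrix.diagonal_map Complex.ofReal_zero]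
  rw [← mul_mul_inv_smul_one_add_mul_diagonal_mul h.conjTranspose_map_ofReal_mul hs hd, ← hneg,
    transferMatrix, map_ofReal_one, Matrix.mul_one, ← h.mul_transpose, map_ofReal_mul,
    conjTranspose_map_ofReal]

end IsReducedDiagonalization

end TransferMatrix

section Integral

variable {a r s t : ℝ}

theorem lintegral_rpow_mul_exp_neg_mul_Ioi (hs : 0 < s) (hr : 0 < r) :
    ∫⁻ t in Set.Ioi (0 : ℝ), ENNReal.ofReal (t ^ (s - 1) * Real.exp (-(r * t))) =
      ENNReal.ofReal ((1 / r) ^ s * Real.Gamma s) := by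
  have hintegral := Real.integral_rpow_mul_exp_neg_mul_Ioi hs hr
  have hpos : 0 < (1 / r) ^ s * Real.Gamma s :=
    mul_pos (Real.rpow_pos_of_pos (one_div_pos.2 hr) _) (Real.Gamma_pos_of_pos hs)
  rw [← hintegral, ofReal_integral_eq_lintegral_ofReal]
  · exact Integrable.of_integral_ne_zero (hintegral ▸ hpos.ne')
  · filter_upwards [ae_restrict_mem measurableSet_Ioi] with t ht
    exact mul_nonneg (Real.rpow_nonneg (le_of_lt ht) _) (Real.exp_pos _).le

theorem lintegral_exp_neg_mul_sq (ht : 0 < t) :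
    ∫⁻ ω : ℝ, ENNReal.ofReal (Real.exp (-t * ω ^ 2)) = ENNReal.ofReal √(Real.pi / t) := by
  rw [← integral_gaussian, ofReal_integral_eq_lintegral_ofReal (integrable_exp_neg_mul_sq ht)]
  exact ae_of_all _ fun _ => (Real.exp_pos _).le

theorem lintegral_rpow_mul_exp_neg_sq_add_sq_mul (a s : ℝ) (ht : 0 < t) :
    ∫⁻ ω : ℝ, ENNReal.ofReal (t ^ (s - 1) * Real.exp (-((a ^ 2 + ω ^ 2) * t))) =
      ENNReal.ofReal √Real.pi *
        ENNReal.ofReal (t ^ (s - 1 / 2 - 1) * Real.exp (-(a ^ 2 * t))) := by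
  have hfactor (ω : ℝ) : ENNReal.ofReal (t ^ (s - 1) * Real.exp (-((a ^ 2 + ω ^ 2) * t))) =
      ENNReal.ofReal (t ^ (s - 1) * Real.exp (-(a ^ 2 * t))) *
        ENNReal.ofReal (Real.exp (-t * ω ^ 2)) := by
    rw [← ENNReal.ofReal_mul (by positivity), mul_assoc, ← Real.exp_add]
    congr 3
    ring
  simp only [hfactor]
  rw [lintegral_const_mul _ (by fun_prop), lintegral_exp_neg_mul_sq ht,
    ← ENNReal.ofReal_mul (by positivity), ← ENNReal.ofReal_mul (by positivity),
    Real.sqrt_div Real.pi_pos.le, sub_right_comm, Real.rpow_sub ht (s - 1) (1 / 2),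
    ← Real.sqrt_eq_rpow]
  congr 1
  ring

-- Integrate `t ^ (s - 1) * exp (-(a ^ 2 + ω ^ 2) * t)` over `t` and `ω`, in both orders.
theorem ofReal_Gamma_mul_lintegral_sq_add_sq_rpow_neg (ha : 0 < a) (hs : 1 / 2 < s) :
    ENNReal.ofReal (Real.Gamma s) * ∫⁻ ω : ℝ, ENNReal.ofReal ((a ^ 2 + ω ^ 2) ^ (-s)) =
      ENNReal.ofReal (√Real.pi * ((1 / a ^ 2) ^ (s - 1 / 2) * Real.Gamma (s - 1 / 2))) := by
  have hs₀ : 0 < s := by linarith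
  have hinner (ω : ℝ) :
      ENNReal.ofReal (Real.Gamma s) * ENNReal.ofReal ((a ^ 2 + ω ^ 2) ^ (-s)) =
        ∫⁻ t in Set.Ioi (0 : ℝ),
          ENNReal.ofReal (t ^ (s - 1) * Real.exp (-((a ^ 2 + ω ^ 2) * t))) := by
    have hpos : 0 < a ^ 2 + ω ^ 2 := by positivity
    rw [lintegral_rpow_mul_exp_neg_mul_Ioi hs₀ hpos,
      ← ENNReal.ofReal_mul (Real.Gamma_pos_of_pos hs₀).le, Real.rpow_neg hpos.le, one_div,
      Real.inv_rpow hpos.le, mul_comm]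
  rw [← lintegral_const_mul' _ _ ENNReal.ofReal_ne_top]
  simp only [hinner]
  rw [lintegral_lintegral_swap, setLIntegral_congr_fun measurableSet_Ioi
      fun t ht => lintegral_rpow_mul_exp_neg_sq_add_sq_mul a s ht,
    lintegral_const_mul' _ _ ENNReal.ofReal_ne_top,
    lintegral_rpow_mul_exp_neg_mul_Ioi (by linarith) (by positivity),
    ← ENNReal.ofReal_mul (Real.sqrt_nonneg _)]
  exact (by fun_prop : Measurable (Function.uncurry fun (ω t : ℝ) =>
    ENNReal.ofReal (t ^ (s - 1) * Real.exp (-((a ^ 2 + ω ^ 2) * t))))).aemeasurable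

theorem lintegral_sq_add_sq_rpow_neg (ha : 0 < a) (hs : 1 / 2 < s) :
    ∫⁻ ω : ℝ, ENNReal.ofReal ((a ^ 2 + ω ^ 2) ^ (-s)) =
      ENNReal.ofReal (√Real.pi * Real.Gamma (s - 1 / 2) / Real.Gamma s * a ^ (-(2 * s - 1))) := by
  have hΓ : 0 < Real.Gamma s := Real.Gamma_pos_of_pos (by linarith)
  have hpow : (1 / a ^ 2) ^ (s - 1 / 2) = a ^ (-(2 * s - 1)) := by
    rw [one_div, ← Real.rpow_natCast, ← Real.rpow_neg ha.le, ← Real.rpow_mul ha.le]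
    congr 1
    push_cast
    ring
  rw [← ENNReal.mul_right_inj (ENNReal.ofReal_pos.2 hΓ).ne' ENNReal.ofReal_ne_top,
    ofReal_Gamma_mul_lintegral_sq_add_sq_rpow_neg ha hs, ← ENNReal.ofReal_mul hΓ.le, hpow]
  congr 1
  field_simp

theorem neg_beta_neg_half (r : ℝ) :
    -ProbabilityTheory.beta (r / 2) (-1 / 2) =
      2 * √Real.pi * Real.Gamma (r / 2) / Real.Gamma ((r - 1) / 2) := by
  have hΓ : Real.Gamma (-1 / 2) = -(2 * √Real.pi) := by
    have hrec := Real.Gamma_add_one (s := -1 / 2) (by norm_num)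
    rw [show (-1 / 2 : ℝ) + 1 = 1 / 2 by norm_num, Real.Gamma_one_half_eq] at hrec
    linarith
  rw [ProbabilityTheory.beta, hΓ, show r / 2 + -1 / 2 = (r - 1) / 2 by ring]
  ring

theorem neg_beta_neg_half_pos (hr : 1 < r) : 0 < -ProbabilityTheory.beta (r / 2) (-1 / 2) := by
  have hΓ := Real.Gamma_pos_of_pos (show 0 < r / 2 by linarith)
  have hΓ' := Real.Gamma_pos_of_pos (show 0 < (r - 1) / 2 by linarith)
  rw [neg_beta_neg_half]
  exact div_pos (mul_pos (by positivity) hΓ) hΓ'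

theorem norm_I_mul_add_inv_rpow (a r ω : ℝ) :
    ‖(Complex.I * ω + a)⁻¹‖ ^ r = (a ^ 2 + ω ^ 2) ^ (-(r / 2)) := by
  have hnorm : ‖Complex.I * ω + a‖ = √(a ^ 2 + ω ^ 2) := by
    rw [Complex.norm_def, Complex.normSq_apply]
    simp [sq]
  have hnonneg : 0 ≤ a ^ 2 + ω ^ 2 := by positivity
  rw [norm_inv, hnorm, Real.inv_rpow (Real.sqrt_nonneg _), Real.sqrt_eq_rpow,
    ← Real.rpow_mul hnonneg, Real.rpow_neg hnonneg, one_div_mul_eq_div]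

theorem lintegral_norm_I_mul_add_inv_rpow (ha : 0 < a) (hr : 1 < r) :
    ENNReal.ofReal (1 / (2 * Real.pi)) *
        ∫⁻ ω : ℝ, ENNReal.ofReal (‖(Complex.I * ω + a)⁻¹‖ ^ r) =
      ENNReal.ofReal ((-ProbabilityTheory.beta (r / 2) (-1 / 2))⁻¹ * a ^ (-(r - 1))) := by
  have hΓ := Real.Gamma_pos_of_pos (show 0 < (r - 1) / 2 by linarith)
  have hsq : √Real.pi ^ 2 = Real.pi := Real.sq_sqrt Real.pi_pos.le
  simp only [norm_I_mul_add_inv_rpow]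
  rw [lintegral_sq_add_sq_rpow_neg ha (by linarith), ← ENNReal.ofReal_mul (by positivity),
    neg_beta_neg_half, ← sub_div, mul_div_cancel₀ r two_ne_zero]
  congr 1
  field_simp
  rw [hsq]

end Integral

section FiniteOrder

variable {n : ℕ} {L : Matrix (Fin n) (Fin n) ℝ} {r : ℝ}

theorem alphaZero_ofReal (hr : 0 ≤ r) : alphaZero (ENNReal.ofReal r) =
    ((-ProbabilityTheory.beta (r / 2) (-1 / 2)) ^ (1 / r))⁻¹ := by
  rw [alphaZero, if_neg ENNReal.ofReal_ne_top, ENNReal.toReal_ofReal hr]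

theorem alphaZero_ofReal_nonneg (hr : 1 < r) : 0 ≤ alphaZero (ENNReal.ofReal r) := by
  rw [alphaZero_ofReal (by linarith)]
  exact inv_nonneg.2 (Real.rpow_nonneg (neg_beta_neg_half_pos hr).le _)

theorem spectralZeta_ofReal (hL : L.IsHermitian) (hr : 0 ≤ r) :
    spectralZeta hL (ENNReal.ofReal r) = spectralPowerSum hL r ^ (1 / r) := by
  rw [spectralZeta, if_neg ENNReal.ofReal_ne_top, ENNReal.toReal_ofReal hr, spectralPowerSum]

theorem spectralZeta_ofReal_sub_one_rpow (hL : L ∈ laplacians n) (hr : 1 < r) :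
    spectralZeta (isHermitian_of_mem_laplacians hL) (ENNReal.ofReal r - 1) ^
        (1 - ((ENNReal.ofReal r)⁻¹).toReal) =
      spectralPowerSum (isHermitian_of_mem_laplacians hL) (r - 1) ^ (1 / r) := by
  have hr₀ : 0 < r := by linarith
  have hr₁ : r - 1 ≠ 0 := by linarith
  rw [← ENNReal.ofReal_one, ← ENNReal.ofReal_sub _ zero_le_one,
    spectralZeta_ofReal _ (by linarith), ENNReal.toReal_inv, ENNReal.toReal_ofReal hr₀.le,
    ← Real.rpow_mul (spectralPowerSum_nonneg hL _)]
  congr 1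
  field_simp

theorem I_mul_ofReal_ne_zero {ω : ℝ} (hω : ω ≠ 0) : Complex.I * ω ≠ 0 :=
  mul_ne_zero Complex.I_ne_zero (Complex.ofReal_ne_zero.2 hω)

theorem I_mul_ofReal_add_ofReal_ne_zero {ω : ℝ} (hω : ω ≠ 0) (x : ℝ) : Complex.I * ω + x ≠ 0 :=
  fun h => hω (by simpa using congrArg Complex.im h)

theorem lintegral_sum_singularValue_rpow (hL : L ∈ laplacians n) (hr : 1 < r) :
    ENNReal.ofReal (1 / (2 * Real.pi)) * ∫⁻ ω : ℝ, ∑ k : Fin n, ENNReal.ofReal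
        (singularValue (transferMatrix (-L) 1 (centering n) (Complex.I * ω)) k ^ r) =
      ENNReal.ofReal ((-ProbabilityTheory.beta (r / 2) (-1 / 2))⁻¹ *
        spectralPowerSum (isHermitian_of_mem_laplacians hL) (r - 1)) := by
  obtain ⟨W, hW⟩ := exists_isReducedDiagonalization_centering hL
  have hpos (i : {i : Fin n // 0 < (i : ℕ)}) := eigenvalue_pos hL i.2
  set d := eigenvalue (isHermitian_of_mem_laplacians hL)
  have hae : ∀ᵐ ω : ℝ, ∑ k : Fin n, ENNReal.ofReal
      (singularValue (transferMatrix (-L) 1 (centering n) (Complex.I * ω)) k ^ r) =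
      ∑ i : {i : Fin n // 0 < (i : ℕ)},
        ENNReal.ofReal (‖(Complex.I * ω + d i)⁻¹‖ ^ r) := by
    filter_upwards [Measure.ae_ne volume (0 : ℝ)] with ω hω
    rw [hW.transferMatrix_eq (I_mul_ofReal_ne_zero hω)
      fun i => I_mul_ofReal_add_ofReal_ne_zero hω (d i)]
    exact sum_map_singularValue hW.conjTranspose_map_ofReal_mul _ (F := fun x =>
      ENNReal.ofReal (x ^ r)) (by simp [Real.zero_rpow (by linarith : r ≠ 0)])
  rw [lintegral_congr_ae hae, lintegral_finsetSum _ fun i _ => by fun_prop, Finset.mul_sum,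
    Finset.sum_congr rfl fun i _ => lintegral_norm_I_mul_add_inv_rpow (hpos i) hr,
    ← ENNReal.ofReal_sum_of_nonneg fun i _ => mul_nonneg
      (inv_nonneg.2 (neg_beta_neg_half_pos hr).le) (Real.rpow_nonneg (hpos i).le _),
    ← Finset.mul_sum, spectralPowerSum]

theorem networkNorm_ofReal (hL : L ∈ laplacians n) (hr : 1 < r) :
    networkNorm (ENNReal.ofReal r) L = ENNReal.ofReal (alphaZero (ENNReal.ofReal r) *
      spectralPowerSum (isHermitian_of_mem_laplacians hL) (r - 1) ^ (1 / r)) := by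
  have hr₀ : 0 ≤ r := by linarith
  have hβ := neg_beta_neg_half_pos hr
  have hsum := spectralPowerSum_nonneg hL (r - 1)
  rw [networkNorm, hardySchattenNorm, if_neg ENNReal.ofReal_ne_top, ENNReal.toReal_ofReal hr₀,
    lintegral_sum_singularValue_rpow hL hr,
    ENNReal.ofReal_rpow_of_nonneg (mul_nonneg (inv_nonneg.2 hβ.le) hsum) (one_div_nonneg.2 hr₀),
    Real.mul_rpow (inv_nonneg.2 hβ.le) hsum, Real.inv_rpow hβ.le, alphaZero_ofReal hr₀]

theorem isSystemicPerformanceMeasure_networkNorm_ofReal (n : ℕ) (hr : 1 < r) :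
    IsSystemicPerformanceMeasure
      fun L : Matrix (Fin n) (Fin n) ℝ => (networkNorm (ENNReal.ofReal r) L).toReal := by
  refine .of_eq_mul_spectralPowerSum_rpow (alphaZero_ofReal_nonneg hr) (by linarith : 0 ≤ r - 1)
    (by positivity : 0 ≤ 1 / r) fun L hL => ?_
  rw [networkNorm_ofReal hL hr, ENNReal.toReal_ofReal (mul_nonneg (alphaZero_ofReal_nonneg hr)
    (Real.rpow_nonneg (spectralPowerSum_nonneg hL _) _))]

end FiniteOrder

section LimitsOfPowers

variable {c r : ℝ} {ι : Type*} [Fintype ι] {x : ι → ℝ}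

theorem tendsto_const_rpow_one_div (hc : 0 < c) :
    Tendsto (fun r : ℝ => c ^ (1 / r)) atTop (𝓝 1) := by
  have hexp : Tendsto (fun r : ℝ => 1 / r) atTop (𝓝 0) := tendsto_const_nhds.div_atTop tendsto_id
  simpa using (tendsto_const_nhds (x := c)).rpow hexp (Or.inl hc.ne')

theorem two_mul_sqrt_pi_le_neg_beta_neg_half (hr : 5 ≤ r) :
    2 * √Real.pi ≤ -ProbabilityTheory.beta (r / 2) (-1 / 2) := by
  have hΓ := Real.Gamma_pos_of_pos (show 0 < (r - 1) / 2 by linarith)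
  have hmono : Real.Gamma ((r - 1) / 2) ≤ Real.Gamma (r / 2) :=
    Real.Gamma_strictMonoOn_Ici.monotoneOn (show 2 ≤ (r - 1) / 2 by linarith)
      (show 2 ≤ r / 2 by linarith) (by linarith)
  rw [neg_beta_neg_half, le_div_iff₀ hΓ]
  gcongr

theorem neg_beta_neg_half_le_two_mul_sqrt_pi_mul (hr : 5 ≤ r) :
    -ProbabilityTheory.beta (r / 2) (-1 / 2) ≤ 2 * √Real.pi * r := by
  have hΓ := Real.Gamma_pos_of_pos (show 0 < (r - 1) / 2 by linarith)
  have hle : Real.Gamma (r / 2) ≤ r * Real.Gamma ((r - 1) / 2) :=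
    calc Real.Gamma (r / 2) ≤ Real.Gamma ((r - 1) / 2 + 1) :=
          Real.Gamma_strictMonoOn_Ici.monotoneOn (show 2 ≤ r / 2 by linarith)
            (show 2 ≤ (r - 1) / 2 + 1 by linarith) (by linarith)
      _ = (r - 1) / 2 * Real.Gamma ((r - 1) / 2) := Real.Gamma_add_one (by linarith)
      _ ≤ r * Real.Gamma ((r - 1) / 2) := by
          gcongr
          linarith
  rw [neg_beta_neg_half, div_le_iff₀ hΓ, mul_assoc _ r]
  gcongr

theorem tendsto_neg_beta_neg_half_rpow_one_div :
    Tendsto (fun r : ℝ => (-ProbabilityTheory.beta (r / 2) (-1 / 2)) ^ (1 / r)) atTop (𝓝 1) := by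
  have hc : 0 < 2 * √Real.pi := by positivity
  have hlower := tendsto_const_rpow_one_div hc
  have hupper : Tendsto (fun r : ℝ => (2 * √Real.pi) ^ (1 / r) * r ^ (1 / r)) atTop (𝓝 1) := by
    simpa using hlower.mul tendsto_rpow_div
  refine tendsto_of_tendsto_of_tendsto_of_le_of_le' hlower hupper ?_ ?_
  · filter_upwards [eventually_ge_atTop 5] with r hr
    gcongr
    exact two_mul_sqrt_pi_le_neg_beta_neg_half hr
  · filter_upwards [eventually_ge_atTop 5] with r hr
    rw [← Real.mul_rpow hc.le (by linarith)]
    exact Real.rpow_le_rpow (neg_beta_neg_half_pos (by linarith)).le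
      (neg_beta_neg_half_le_two_mul_sqrt_pi_mul hr) (by positivity)

theorem iSup_le_sum_rpow_rpow_one_div (hx : ∀ i, 0 ≤ x i) (hr : 0 < r) :
    ⨆ i, x i ≤ (∑ i, x i ^ r) ^ (1 / r) := by
  have hpow (i : ι) : 0 ≤ x i ^ r := Real.rpow_nonneg (hx i) r
  refine Real.iSup_le (fun i => ?_)
    (Real.rpow_nonneg (Finset.sum_nonneg fun i _ => hpow i) _)
  rw [one_div, Real.le_rpow_inv_iff_of_pos (hx i) (Finset.sum_nonneg fun i _ => hpow i) hr]
  exact Finset.single_le_sum (f := fun i => x i ^ r) (fun i _ => hpow i) (Finset.mem_univ i)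

theorem sum_rpow_rpow_one_div_le (hx : ∀ i, 0 ≤ x i) (hr : 0 < r) :
    (∑ i, x i ^ r) ^ (1 / r) ≤ (Fintype.card ι : ℝ) ^ (1 / r) * ⨆ i, x i := by
  have hsup : 0 ≤ ⨆ i, x i := Real.iSup_nonneg hx
  have hsum : ∑ i, x i ^ r ≤ Fintype.card ι * (⨆ i, x i) ^ r := by
    rw [← nsmul_eq_mul]
    exact Finset.sum_le_card_nsmul _ _ _ fun i _ =>
      Real.rpow_le_rpow (hx i) (le_ciSup (Set.finite_range x).bddAbove i) hr.le
  calc (∑ i, x i ^ r) ^ (1 / r)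
      ≤ (Fintype.card ι * (⨆ i, x i) ^ r) ^ (1 / r) := Real.rpow_le_rpow
        (Finset.sum_nonneg fun i _ => Real.rpow_nonneg (hx i) r) hsum (by positivity)
    _ = (Fintype.card ι : ℝ) ^ (1 / r) * ⨆ i, x i := by
        rw [Real.mul_rpow (Nat.cast_nonneg _) (Real.rpow_nonneg hsup r), one_div,
          Real.rpow_rpow_inv hsup hr.ne']

theorem tendsto_sum_rpow_rpow_one_div (hx : ∀ i, 0 ≤ x i) :
    Tendsto (fun r : ℝ => (∑ i, x i ^ r) ^ (1 / r)) atTop (𝓝 (⨆ i, x i)) := by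
  have hupper : Tendsto (fun r : ℝ => (Fintype.card ι : ℝ) ^ (1 / r) * ⨆ i, x i) atTop
      (𝓝 (⨆ i, x i)) := by
    rcases isEmpty_or_nonempty ι with hι | hι
    · simp [Real.iSup_of_isEmpty]
    · simpa using (tendsto_const_rpow_one_div (Nat.cast_pos.2 Fintype.card_pos)).mul_const _
  refine tendsto_of_tendsto_of_tendsto_of_le_of_le' tendsto_const_nhds hupper ?_ ?_
  · filter_upwards [eventually_gt_atTop 0] with r hr using iSup_le_sum_rpow_rpow_one_div hx hr
  · filter_upwards [eventually_gt_atTop 0] with r hr using sum_rpow_rpow_one_div_le hx hr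

end LimitsOfPowers

section EssentialSupremum

theorem essSup_eq_iSup_of_lowerSemicontinuous {X β : Type*} [TopologicalSpace X]
    [MeasurableSpace X] {μ : Measure X} [μ.IsOpenPosMeasure] [CompleteLinearOrder β] {f : X → β}
    (hf : LowerSemicontinuous f) : essSup f μ = ⨆ x, f x :=
  (iSup_eq_essSup fun x a hx => (hf.isOpen_preimage a).measure_ne_zero μ ⟨x, hx⟩).symm

theorem ofReal_iSup {ι : Type*} [Finite ι] (x : ι → ℝ) :
    ENNReal.ofReal (⨆ i, x i) = ⨆ i, ENNReal.ofReal (x i) := by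
  rcases isEmpty_or_nonempty ι with hι | hι
  · simp
  · exact Monotone.map_ciSup_of_continuousAt ENNReal.continuous_ofReal.continuousAt
      ENNReal.ofReal_mono (Set.finite_range x).bddAbove

variable {a : ℝ}

theorem I_mul_ofReal_add_ofReal_ne_zero_of_pos (ha : 0 < a) (ω : ℝ) : Complex.I * ω + a ≠ 0 :=
  fun h => ha.ne' (by simpa using congrArg Complex.re h)

theorem continuous_enorm_I_mul_add_inv (ha : 0 < a) :
    Continuous fun ω : ℝ => ‖(Complex.I * ω + a)⁻¹‖ₑ :=
  (Continuous.inv₀ (by fun_prop) (I_mul_ofReal_add_ofReal_ne_zero_of_pos ha)).enorm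

theorem iSup_enorm_I_mul_add_inv (ha : 0 < a) :
    ⨆ ω : ℝ, ‖(Complex.I * ω + a)⁻¹‖ₑ = ENNReal.ofReal a⁻¹ := by
  refine le_antisymm (iSup_le fun ω => ?_) (le_iSup_of_le 0 ?_)
  · have hle : a ≤ ‖Complex.I * ω + a‖ := by
      simpa using Complex.re_le_norm (Complex.I * ω + a)
    rw [← ofReal_norm, norm_inv]
    gcongr
  · rw [← ofReal_norm]
    simp [abs_of_pos ha]

end EssentialSupremum

section InfiniteOrder

variable {n : ℕ} {L : Matrix (Fin n) (Fin n) ℝ} {p : ℝ≥0∞}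

theorem alphaZero_top : alphaZero ∞ = 1 := if_pos rfl

theorem tendsto_alphaZero :
    Tendsto (fun r : ℝ => alphaZero (ENNReal.ofReal r)) atTop (𝓝 (alphaZero ∞)) := by
  rw [alphaZero_top, ← inv_one]
  refine (tendsto_neg_beta_neg_half_rpow_one_div.inv₀ one_ne_zero).congr' ?_
  filter_upwards [eventually_ge_atTop 0] with r hr using (alphaZero_ofReal hr).symm

theorem tendsto_spectralZeta (hL : L ∈ laplacians n) :
    Tendsto (fun r : ℝ => spectralZeta (isHermitian_of_mem_laplacians hL) (ENNReal.ofReal r))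
      atTop (𝓝 (spectralZeta (isHermitian_of_mem_laplacians hL) ∞)) := by
  have hpos (i : {i : Fin n // 0 < (i : ℕ)}) := eigenvalue_pos hL i.2
  rw [spectralZeta, if_pos rfl]
  refine (tendsto_sum_rpow_rpow_one_div fun i => (inv_pos.2 (hpos i)).le).congr' ?_
  filter_upwards [eventually_ge_atTop 0] with r hr
  rw [spectralZeta_ofReal _ hr, spectralPowerSum]
  simp only [Real.rpow_neg (hpos _).le, Real.inv_rpow (hpos _).le]

theorem networkNorm_top (hL : L ∈ laplacians n) :
    networkNorm ∞ L = ENNReal.ofReal (spectralZeta (isHermitian_of_mem_laplacians hL) ∞) := by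
  obtain ⟨W, hW⟩ := exists_isReducedDiagonalization_centering hL
  have hpos (i : {i : Fin n // 0 < (i : ℕ)}) := eigenvalue_pos hL i.2
  set d := eigenvalue (isHermitian_of_mem_laplacians hL)
  have hae : (fun ω : ℝ => ENNReal.ofReal
        (singularValue (transferMatrix (-L) 1 (centering n) (Complex.I * ω)) 0)) =ᵐ[volume]
      fun ω : ℝ => ⨆ i : {i : Fin n // 0 < (i : ℕ)}, ‖(Complex.I * ω + d i)⁻¹‖ₑ := by
    filter_upwards [Measure.ae_ne volume (0 : ℝ)] with ω hω
    rw [hW.transferMatrix_eq (I_mul_ofReal_ne_zero hω)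
      fun i => I_mul_ofReal_add_ofReal_ne_zero hω (d i)]
    exact ofReal_singularValue_zero hW.conjTranspose_map_ofReal_mul _
  rw [networkNorm, hardySchattenNorm, if_pos rfl, essSup_congr_ae hae,
    essSup_eq_iSup_of_lowerSemicontinuous (lowerSemicontinuous_iSup fun i =>
      (continuous_enorm_I_mul_add_inv (hpos i)).lowerSemicontinuous), iSup_comm,
    spectralZeta, if_pos rfl, ofReal_iSup]
  exact iSup_congr fun i => iSup_enorm_I_mul_add_inv (hpos i)

theorem exists_eq_ofReal_of_one_lt (hp : 1 < p) (hp' : p ≠ ∞) :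
    ∃ r : ℝ, 1 < r ∧ p = ENNReal.ofReal r :=
  ⟨p.toReal, by simpa using (ENNReal.toReal_lt_toReal ENNReal.one_ne_top hp').2 hp,
    (ENNReal.ofReal_toReal hp').symm⟩

theorem networkNorm_eq_spectralZeta (hL : L ∈ laplacians n) (hp : 1 < p) :
    networkNorm p L = ENNReal.ofReal (alphaZero p *
      spectralZeta (isHermitian_of_mem_laplacians hL) (p - 1) ^ (1 - (p⁻¹).toReal)) := by
  rcases eq_or_ne p ∞ with rfl | hp'
  · simp [networkNorm_top hL, alphaZero_top]
  · obtain ⟨r, hr, rfl⟩ := exists_eq_ofReal_of_one_lt hp hp'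
    rw [networkNorm_ofReal hL hr, spectralZeta_ofReal_sub_one_rpow hL hr]

theorem tendsto_networkNorm (hL : L ∈ laplacians n) :
    Tendsto (fun r : ℝ => networkNorm (ENNReal.ofReal r) L) atTop (𝓝 (networkNorm ∞ L)) := by
  have hζ := (tendsto_spectralZeta hL).comp
    (tendsto_atTop_add_const_right atTop (-1 : ℝ) tendsto_id)
  have hexp : Tendsto (fun r : ℝ => 1 - r⁻¹) atTop (𝓝 1) := by
    simpa using (tendsto_const_nhds (x := (1 : ℝ))).sub tendsto_inv_atTop_zero
  have hlim := ENNReal.tendsto_ofReal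
    (tendsto_alphaZero.mul (hζ.rpow hexp (Or.inr one_pos)))
  rw [alphaZero_top, one_mul, Real.rpow_one, ← networkNorm_top hL] at hlim
  refine hlim.congr' ?_
  filter_upwards [eventually_gt_atTop 1] with r hr
  rw [networkNorm_eq_spectralZeta hL (by simpa using hr), ENNReal.toReal_inv,
    ENNReal.toReal_ofReal (by linarith), ← ENNReal.ofReal_one, ← ENNReal.ofReal_sub _ zero_le_one]
  rfl

theorem isSystemicPerformanceMeasure_networkNorm (n : ℕ) (hp : 1 < p) :
    IsSystemicPerformanceMeasure
      fun L : Matrix (Fin n) (Fin n) ℝ => (networkNorm p L).toReal := by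
  rcases eq_or_ne p ∞ with rfl | hp'
  · refine .of_tendsto (l := atTop)
      (ρ := fun (r : ℝ) L => (networkNorm (ENNReal.ofReal r) L).toReal) ?_ fun L hL => ?_
    · filter_upwards [eventually_gt_atTop 1] with r hr using
        isSystemicPerformanceMeasure_networkNorm_ofReal n hr
    · have hfinite : networkNorm ∞ L ≠ ∞ := networkNorm_top hL ▸ ENNReal.ofReal_ne_top
      exact (ENNReal.tendsto_toReal hfinite).comp (tendsto_networkNorm hL)
  · obtain ⟨r, hr, rfl⟩ := exists_eq_ofReal_of_one_lt hp hp'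
    exact isSystemicPerformanceMeasure_networkNorm_ofReal n hr

end InfiniteOrder

end ConsensusNetwork

theorem mainTheorem12_general (n : ℕ) (p : ℝ≥0∞) (hp : 1 < p) :
    ConsensusNetwork.IsSystemicPerformanceMeasure
      (fun L : Matrix (Fin n) (Fin n) ℝ => (ConsensusNetwork.networkNorm p L).toReal) ∧
    (∀ (L : Matrix (Fin n) (Fin n) ℝ) (hL : L ∈ ConsensusNetwork.laplacians n),
      ConsensusNetwork.networkNorm p L = ENNReal.ofReal (ConsensusNetwork.alphaZero p *
        ConsensusNetwork.spectralZeta (ConsensusNetwork.isHermitian_of_mem_laplacians hL) (p - 1) ^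
          (1 - (p⁻¹).toReal))) ∧
    Tendsto (fun r : ℝ => ConsensusNetwork.alphaZero (ENNReal.ofReal r)) atTop
      (𝓝 (ConsensusNetwork.alphaZero ∞)) ∧
    (∀ (L : Matrix (Fin n) (Fin n) ℝ) (hL : L ∈ ConsensusNetwork.laplacians n),
      Tendsto (fun r : ℝ => ConsensusNetwork.spectralZeta
          (ConsensusNetwork.isHermitian_of_mem_laplacians hL) (ENNReal.ofReal r)) atTop
        (𝓝 (ConsensusNetwork.spectralZeta
          (ConsensusNetwork.isHermitian_of_mem_laplacians hL) ∞)) ∧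
      Tendsto (fun r : ℝ => ConsensusNetwork.networkNorm (ENNReal.ofReal r) L) atTop
        (𝓝 (ConsensusNetwork.networkNorm ∞ L))) :=
  ⟨ConsensusNetwork.isSystemicPerformanceMeasure_networkNorm n hp,
    fun _ hL => ConsensusNetwork.networkNorm_eq_spectralZeta hL hp,
    ConsensusNetwork.tendsto_alphaZero,
    fun _ hL => ⟨ConsensusNetwork.tendsto_spectralZeta hL,
      ConsensusNetwork.tendsto_networkNorm hL⟩⟩

theorem mainTheorem12 (n : ℕ) (p : ℝ≥0∞) (hp : 2 ≤ p) :
    ConsensusNetwork.IsSystemicPerformanceMeasure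
      (fun L : Matrix (Fin n) (Fin n) ℝ => (ConsensusNetwork.networkNorm p L).toReal) ∧
    (∀ (L : Matrix (Fin n) (Fin n) ℝ) (hL : L ∈ ConsensusNetwork.laplacians n),
      ConsensusNetwork.networkNorm p L = ENNReal.ofReal (ConsensusNetwork.alphaZero p *
        ConsensusNetwork.spectralZeta (ConsensusNetwork.isHermitian_of_mem_laplacians hL) (p - 1) ^
          (1 - (p⁻¹).toReal))) ∧
    -- the three quantities at infinite order are the limits of those at finite order
    Tendsto (fun r : ℝ => ConsensusNetwork.alphaZero (ENNReal.ofReal r)) atTop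
      (𝓝 (ConsensusNetwork.alphaZero ∞)) ∧
    (∀ (L : Matrix (Fin n) (Fin n) ℝ) (hL : L ∈ ConsensusNetwork.laplacians n),
      Tendsto (fun r : ℝ => ConsensusNetwork.spectralZeta
          (ConsensusNetwork.isHermitian_of_mem_laplacians hL) (ENNReal.ofReal r)) atTop
        (𝓝 (ConsensusNetwork.spectralZeta
          (ConsensusNetwork.isHermitian_of_mem_laplacians hL) ∞)) ∧
      Tendsto (fun r : ℝ => ConsensusNetwork.networkNorm (ENNReal.ofReal r) L) atTop
        (𝓝 (ConsensusNetwork.networkNorm ∞ L))) :=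
  mainTheorem12_general n p (ENNReal.one_lt_two.trans_le hp)
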